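/- **Setting.** Let $h:\mathbb{R}^n\to\mathbb{R}$ be a Legendre function with full domain (convex, differentiable and strictly convex on $\mathbb{R}^n$), let $h^*(u)=\sup_x\langle u,x\rangle-h(x)$ be its convex conjugate, let $h_-:=h(-\,\cdot\,)$, and for $\lambda>0$ write $(\lambda\star h)(x)=\lambda h(\lambda^{-1}x)$. Let $L>0$ and let $f:\mathbb{R}^n\to\mathbb{R}$ be such that $p:=-f$ is anisotropically smooth relative to $h$ with constant $L$, that is, $p$ is continuously differentiable, $\operatorname{ran}\nabla p\subseteq\operatorname{ran}\nabla h$, and for all $x,\bar x\in\mathbb{R}^n$ $$p(x)\le p(\bar x)+\tfrac1L\star h\bigl(x-\bar x+\tfrac1L\nabla h^*(\nabla p(\bar x))\bigr)-\tfrac1L\star h\bigl(\tfrac1L\nabla h^*(\nabla p(\bar x))\bigr).$$ Let $g:\mathbb{R}^n\to\overline{\mathbb{R}}$ be proper and lower semicontinuous and such that $g+\tfrac1L\star h(\cdot-y)$ is level-bounded for every $y\in\mathbb{R}^n$. Put $F=g-f$ and $\Phi(x,y)=-\tfrac1L\star h(x-y)$. For $\psi:\mathbb{R}^n\to\overline{\mathbb{R}}$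 let $\psi^\Phi(y)=\sup_x\Phi(x,y)-\psi(x)$, let $\partial_\Phi\psi(\bar x)$ be the set of all $y$ with $\psi(x)\ge\psi(\bar x)+\Phi(x,y)-\Phi(\bar x,y)$ for all $x$, and define the primal and dual gaps $$\operatorname{gap}_g^\Phi(x,y)=g(x)+g^\Phi(y)-\Phi(x,y),\qquad \operatorname{gap}_f^\Phi(y,x)=f(x)+f^\Phi(y)-\Phi(x,y).$$ A proper lsc convex function $\psi$ is called anisotropically strongly convex relative to a full-domain Legendre function $k$ with constant $\eta>0$ if $\operatorname{ran}\partial\psi\supseteq\operatorname{ran}\nabla k$ and, for all $\bar x$, all $\bar u\in\partial\psi(\bar x)\cap\operatorname{int}\operatorname{dom}k^*$ and all $x\in\mathbb{R}^n$, $$\psi(x)\ge\psi(\bar x)+\tfrac1\eta\star k\bigl(x-\bar x+\tfrac1\eta\nabla k^*(\bar u)\bigr)-\tfrac1\eta\star k\bigl(\tfrac1\eta\nabla k^*(\bar u)\bigr).$$ **Lemma.** (i) Let $\bar x\in\mathbb{R}^n$, $\bar y=\bar x-\tfrac1L\nabla h^*(-\nabla f(\bar x))$ and $x^+\in\operatorname{argmin}_{x}\,g(x)+\tfrac1L\star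 h(x-\bar y)$. Then $$\operatorname{gap}_g^\Phi(\bar x,\bar y)=g(\bar x)-\min_{x\in\mathbb{R}^n}\bigl\{g(x)+\tfrac1L\star h(x-\bar y)\bigr\}+\tfrac1L\star h\bigl(\tfrac1L\nabla h^*(-\nabla f(\bar x))\bigr),$$ $$\operatorname{gap}_f^\Phi(\bar y,x^+)=-f(\bar x)+f(x^+)+\tfrac1L\star h(x^+-\bar y)-\tfrac1L\star h\bigl(\tfrac1L\nabla h^*(-\nabla f(\bar x))\bigr).$$ (ii) Suppose that $-f$ is anisotropically strongly convex relative to $h$ with constant $\eta_f>0$ and $g$ is anisotropically strongly convex relative to $h_-$ with constant $\eta_g>0$ (if $h$ is even, then $h_-=h$). Then $F$ satisfies the $\Phi$-DCA-PL inequality with $\mu_1=\eta_f/L$ and $\mu_2=\eta_g/L$: $\mu_1+\mu_2>0$, and for all $\bar x\in\operatorname{dom}F$, $\bar y\in\partial_\Phi f(\bar x)$ and $x^+\in\operatorname{argmin}_x\,g(x)-\Phi(x,\bar y)$, $$\operatorname{gap}_g^\Phi(\bar x,\bar y)+\operatorname{gap}_f^\Phi(\bar y,x^+)\ \ge\ \mu_1\bigl(F(\bar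 x)-\inf F\bigr)+\mu_2\bigl(F(x^+)-\inf F\bigr).$$ Consequently, for all sequences with $y^k\in\partial_\Phi f(x^k)$ and $y^k\in\partial_\Phi g(x^{k+1})$, $k\ge0$, the values $F(x^k)$ converge $q$-linearly: whenever $x^k\in\operatorname{dom}F$, $$F(x^{k+1})-\inf F\ \le\ \frac{1-\eta_f/L}{1+\eta_g/L}\,\bigl(F(x^k)-\inf F\bigr),\qquad \frac{1-\eta_f/L}{1+\eta_g/L}<1.$$ -/

import Mathlib

open Set

noncomputable section

/-! ### Generalized convexity for a real-valued coupling -/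

/-- The `Φ`-conjugate `f^Φ(y) = sup_x Φ(x, y) - f(x)`. -/
def phiConj {X Y : Type*} (Φ : X → Y → ℝ) (f : X → EReal) (y : Y) : EReal :=
  ⨆ x, ((Φ x y : ℝ) : EReal) - f x

/-- The `Φ`-subdifferential of `f` at `xbar`. -/
def phiSubdiff {X Y : Type*} (Φ : X → Y → ℝ) (f : X → EReal) (xbar : X) : Set Y :=
  {y | ∀ x, f xbar + ((Φ x y - Φ xbar y : ℝ) : EReal) ≤ f x}

/-- The regularized gap function `g(x) + g^Φ(y) - Φ(x, y)`. The primal gap is `phiGap Φ g x y`;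
the dual gap, written with the arguments in the order `(y, x)` on paper, is `phiGap Φ f x y`. -/
def phiGap {X Y : Type*} (Φ : X → Y → ℝ) (g : X → EReal) (x : X) (y : Y) : EReal :=
  g x + phiConj Φ g y - ((Φ x y : ℝ) : EReal)

open Classical in
/-- The objective `F = g - f`, with the convention `∞ - ∞ = ∞`. -/
def dcObjective {X : Type*} (g f : X → EReal) (x : X) : EReal :=
  if g x = ⊤ then ⊤ else g x - f x

/-- The set of global minimizers of `φ`. -/
def argminSet {X : Type*} (φ : X → EReal) : Set X :=
  {x | ∀ z, φ x ≤ φ z}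

/-- The `Φ`-DCA-PL inequality for `F = g - f` with constants `μ₁`, `μ₂`. -/
def PhiDCAPL {X Y : Type*} (Φ : X → Y → ℝ) (g f : X → EReal) (μ₁ μ₂ : ℝ) : Prop :=
  0 < μ₁ + μ₂ ∧
    ∀ xbar, dcObjective g f xbar < ⊤ →
      ∀ ybar ∈ phiSubdiff Φ f xbar,
        ∀ xplus ∈ argminSet (fun x => g x - ((Φ x ybar : ℝ) : EReal)),
          (μ₁ : EReal) * (dcObjective g f xbar - ⨅ z, dcObjective g f z)
              + (μ₂ : EReal) * (dcObjective g f xplus - ⨅ z, dcObjective g f z)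
            ≤ phiGap Φ g xbar ybar + phiGap Φ f xplus ybar

/-- `(x, y)` are iterates of the `Φ`-DCA: `y^k ∈ ∂_Φ f(x^k)` and `x^{k+1} ∈ (∂_Φ g)⁻¹(y^k)`. -/
def IsPhiDCA {X Y : Type*} (Φ : X → Y → ℝ) (g f : X → EReal) (x : ℕ → X) (y : ℕ → Y) : Prop :=
  ∀ k, y k ∈ phiSubdiff Φ f (x k) ∧ y k ∈ phiSubdiff Φ g (x (k + 1))

/-! ### Extended real-valued functions on Euclidean space -/

/-- Proper: not identically `+∞` and nowhere `-∞`. -/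
def IsProperFun {X : Type*} (ψ : X → EReal) : Prop :=
  (∃ x, ψ x < ⊤) ∧ ∀ x, ⊥ < ψ x

/-- All real sublevel sets are bounded. -/
def IsLevelBounded {n : ℕ} (ψ : EuclideanSpace ℝ (Fin n) → EReal) : Prop :=
  ∀ α : ℝ, Bornology.IsBounded {x | ψ x ≤ (α : EReal)}

/-- The class `Γ₀` of proper, lsc, convex functions; convexity means convexity of the epigraph. -/
def IsGammaZero {n : ℕ} (ψ : EuclideanSpace ℝ (Fin n) → EReal) : Prop :=
  IsProperFun ψ ∧ LowerSemicontinuous ψ ∧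
    Convex ℝ {p : EuclideanSpace ℝ (Fin n) × ℝ | ψ p.1 ≤ ((p.2 : ℝ) : EReal)}

/-- The subdifferential of convex analysis. -/
def convexSubdiff {n : ℕ} (ψ : EuclideanSpace ℝ (Fin n) → EReal)
    (xbar : EuclideanSpace ℝ (Fin n)) : Set (EuclideanSpace ℝ (Fin n)) :=
  {u | ∀ x, ψ xbar + ((inner ℝ u (x - xbar) : ℝ) : EReal) ≤ ψ x}

/-! ### The reference function -/

/-- Legendre type functions with full domain. As the domain has no boundary, essential smoothness
is convexity with differentiability everywhere; since the subdifferential is nonempty everywhere,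
essential strict convexity is strict convexity on the whole space. -/
structure IsFullLegendre {n : ℕ} (h : EuclideanSpace ℝ (Fin n) → ℝ) : Prop where
  differentiable : Differentiable ℝ h
  strictConvex : StrictConvexOn ℝ univ h

/-- The convex conjugate `h*(u) = sup_x ⟨u, x⟩ - h(x)`. -/
def fenchelConj {n : ℕ} (h : EuclideanSpace ℝ (Fin n) → ℝ)
    (u : EuclideanSpace ℝ (Fin n)) : EReal :=
  ⨆ x, ((inner ℝ u x - h x : ℝ) : EReal)

/-- The effective domain of `h*`. -/
def fenchelDom {n : ℕ} (h : EuclideanSpace ℝ (Fin n) → ℝ) : Set (EuclideanSpace ℝ (Fin n)) :=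
  {u | fenchelConj h u < ⊤}

/-- `∇h*(u)`, meaningful for `u` in the interior of the domain of `h*`, where `h*` is finite. -/
def gradConj {n : ℕ} (h : EuclideanSpace ℝ (Fin n) → ℝ)
    (u : EuclideanSpace ℝ (Fin n)) : EuclideanSpace ℝ (Fin n) :=
  gradient (fun v => (fenchelConj h v).toReal) u

/-- The epi-scaling `(lam ⋆ h)(x) = lam h(lam⁻¹ x)`, for `lam > 0`. -/
def epiScale {n : ℕ} (lam : ℝ) (h : EuclideanSpace ℝ (Fin n) → ℝ)
    (x : EuclideanSpace ℝ (Fin n)) : ℝ :=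
  lam * h (lam⁻¹ • x)

/-- The coupling `Φ(x, y) = -((1/L) ⋆ h)(x - y)`. -/
def anisoCoupling {n : ℕ} (h : EuclideanSpace ℝ (Fin n) → ℝ) (L : ℝ)
    (x y : EuclideanSpace ℝ (Fin n)) : ℝ :=
  -epiScale (1 / L) h (x - y)

/-- `p` is anisotropically smooth relative to `h` with constant `L`: it is continuously
differentiable, its gradients lie in the range of `∇h` (so that `∇h*(∇p(xbar))` is defined), and
the anisotropic descent inequality holds. -/
structure AnisoSmooth {n : ℕ} (h : EuclideanSpace ℝ (Fin n) → ℝ) (L : ℝ)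
    (p : EuclideanSpace ℝ (Fin n) → ℝ) : Prop where
  contDiff : ContDiff ℝ 1 p
  range_subset : range (gradient p) ⊆ range (gradient h)
  descent : ∀ xbar x,
    p x ≤ p xbar + epiScale (1 / L) h (x - xbar + L⁻¹ • gradConj h (gradient p xbar))
      - epiScale (1 / L) h (L⁻¹ • gradConj h (gradient p xbar))

/-- `ψ` is anisotropically strongly convex relative to `h` with constant `η`. -/
structure AnisoStronglyConvex {n : ℕ} (h : EuclideanSpace ℝ (Fin n) → ℝ) (η : ℝ)
    (ψ : EuclideanSpace ℝ (Fin n) → EReal) : Prop where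
  gammaZero : IsGammaZero ψ
  range_subset : range (gradient h) ⊆ {u | ∃ x, u ∈ convexSubdiff ψ x}
  lower_bound : ∀ xbar, ∀ ubar ∈ convexSubdiff ψ xbar, ubar ∈ interior (fenchelDom h) → ∀ x,
    ψ xbar + ((epiScale (1 / η) h (x - xbar + η⁻¹ • gradConj h ubar)
        - epiScale (1 / η) h (η⁻¹ • gradConj h ubar) : ℝ) : EReal) ≤ ψ x

/-- The reflection `h(-·)`; it equals `h` when `h` is even. -/
def reflect {n : ℕ} (h : EuclideanSpace ℝ (Fin n) → ℝ) : EuclideanSpace ℝ (Fin n) → ℝ :=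
  fun x => h (-x)

end

/-!
If `y ∈ ∂_Φ f(x)`, then `-Φ(·, y)` touches the convex function `-f` from above at `x`, so
`∇h(w) ∈ ∂(-f)(x)` for `w = L(x - y)`. Since `∇h*` inverts `∇h`, strong convexity of `-f` at this
subgradient reads `h(w + η(z - x)) - h(w) ≤ η(f(x) - f(z))`, and the left side is `L` times the
decrease of `Φ(·, y)` from `x` to `p = x + (η/L)(z - x)`. Testing the infimum in
`gap_g(x, y) = g(x) - Φ(x, y) - inf (g - Φ(·, y))` at `p`, and using convexity of `g` along the
segment from `x` to `z`, yields `(η/L)(F(x) - F(z)) ≤ gap_g(x, y)`; here `η ≤ L` because otherwise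
strong convexity would contradict the strict concavity of `Φ(·, y)`. The dual gap is treated in the
same way at `x⁺`, with `Φ(·, y)` touching `g` from below, the test point `x⁺ + (η/L)(x⁺ - z)` on the
other side of `x⁺`, and convexity of `-f`. As the two gaps add up to `F(x) - F(x⁺)`, the PL
inequality is a contraction estimate.
-/

section Coupling

variable {X Y : Type*} {Φ : X → Y → ℝ} {ψ g : X → EReal} {f : X → ℝ} {x x' z : X} {y : Y}

lemma IsProperFun.exists_coe_eq (hψ : IsProperFun ψ) (hx : ψ x ≠ ⊤) : ∃ a : ℝ, ψ x = a :=
  ⟨_, (EReal.coe_toReal hx (hψ.2 x).ne').symm⟩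

lemma IsProperFun.exists_coe_eq_of_mem_phiSubdiff (hψ : IsProperFun ψ)
    (hy : y ∈ phiSubdiff Φ ψ x) : ∃ a : ℝ, ψ x = a := by
  refine hψ.exists_coe_eq fun htop => ?_
  obtain ⟨z, hz⟩ := hψ.1
  refine (hy z).not_gt ?_
  rwa [htop, EReal.top_add_coe]

lemma iInf_eq_of_mem_argminSet (hx : x ∈ argminSet ψ) : ⨅ z, ψ z = ψ x :=
  le_antisymm (iInf_le _ x) (le_iInf hx)

lemma mem_phiSubdiff_iff_mem_argminSet :
    y ∈ phiSubdiff Φ ψ x ↔ x ∈ argminSet (fun z => ψ z - (Φ z y : EReal)) := by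
  refine forall_congr' fun z => ?_
  beta_reduce
  rw [EReal.le_sub_iff_add_le (.inl (EReal.coe_ne_bot _)) (.inl (EReal.coe_ne_top _)),
    EReal.coe_sub, sub_eq_add_neg, sub_eq_add_neg, add_assoc, add_comm (Φ z y : EReal)]

lemma coe_mem_phiSubdiff_iff :
    y ∈ phiSubdiff Φ (fun x => (f x : EReal)) x ↔ ∀ z, f x + (Φ z y - Φ x y) ≤ f z := by
  simp only [phiSubdiff, mem_ofPred_eq, ← EReal.coe_add, EReal.coe_le_coe_iff]

lemma phiConj_eq_neg_iInf (Φ : X → Y → ℝ) (ψ : X → EReal) (y : Y) :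
    phiConj Φ ψ y = -⨅ x, (ψ x - (Φ x y : EReal)) := by
  have hneg : -⨅ x, (ψ x - (Φ x y : EReal)) = ⨆ x, -(ψ x - (Φ x y : EReal)) :=
    EReal.negOrderIso.map_iInf _
  rw [hneg, phiConj]
  refine iSup_congr fun x => ?_
  rw [EReal.neg_sub (.inr (EReal.coe_ne_bot _)) (.inr (EReal.coe_ne_top _)), add_comm,
    sub_eq_add_neg]

lemma phiGap_eq_sub_iInf (Φ : X → Y → ℝ) (ψ : X → EReal) (x : X) (y : Y) :
    phiGap Φ ψ x y = ψ x - (⨅ z, (ψ z - (Φ z y : EReal))) + ((-Φ x y : ℝ) : EReal) := by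
  rw [phiGap, phiConj_eq_neg_iInf, EReal.coe_neg, ← sub_eq_add_neg, ← sub_eq_add_neg]

lemma phiGap_eq_coe_of_mem_phiSubdiff (hy : y ∈ phiSubdiff Φ ψ x) {a c : ℝ} (ha : ψ x = a)
    (hc : ψ z = c) : phiGap Φ ψ z y = ((c - a + (Φ x y - Φ z y) : ℝ) : EReal) := by
  rw [phiGap_eq_sub_iInf, iInf_eq_of_mem_argminSet (mem_phiSubdiff_iff_mem_argminSet.1 hy), ha, hc]
  norm_cast
  ring

lemma coe_sub_add_le_phiGap {a c : ℝ} (ha : ψ x = a) (hc : ψ z ≤ c) :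
    ((a - c + (Φ z y - Φ x y) : ℝ) : EReal) ≤ phiGap Φ ψ x y := by
  have hinf : (⨅ z, (ψ z - (Φ z y : EReal))) ≤ ((c - Φ z y : ℝ) : EReal) :=
    (iInf_le _ z).trans (by rw [EReal.coe_sub]; exact EReal.sub_le_sub hc le_rfl)
  rw [phiGap_eq_sub_iInf, ha]
  refine le_trans (le_of_eq ?_) (add_le_add_left (EReal.sub_le_sub le_rfl hinf) _)
  norm_cast
  ring

lemma dcObjective_eq_coe {a : ℝ} (ha : g x = a) :
    dcObjective g (fun x => (f x : EReal)) x = ((a - f x : ℝ) : EReal) := by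
  rw [dcObjective, if_neg (by simp [ha]), ha, EReal.coe_sub]

lemma IsProperFun.exists_coe_eq_of_dcObjective_lt_top (hg : IsProperFun g)
    {φ : X → EReal} (hx : dcObjective g φ x < ⊤) : ∃ a : ℝ, g x = a :=
  hg.exists_coe_eq fun htop => hx.ne (if_pos htop)

lemma coe_mul_coe_sub_le_coe_iff {μ r s : ℝ} (hμ : 0 < μ) (e : EReal) :
    (μ : EReal) * (r - e) ≤ s ↔ ((r - s / μ : ℝ) : EReal) ≤ e := by
  induction e with
  | bot =>
    rw [EReal.coe_sub_bot, EReal.coe_mul_top_of_pos hμ, top_le_iff, le_bot_iff]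
    exact iff_of_false (EReal.coe_ne_top s) (EReal.coe_ne_bot _)
  | top => simp [EReal.coe_mul_bot_of_pos hμ]
  | coe t =>
    norm_cast
    rw [mul_comm, ← le_div_iff₀ hμ, sub_le_comm]

lemma coe_mul_dcObjective_sub_iInf_le (hg : IsProperFun g) {μ : ℝ} (hμ : 0 < μ) {a s : ℝ}
    (ha : g x = a) (hs : ∀ z, ∀ c : ℝ, g z = c → μ * ((a - f x) - (c - f z)) ≤ s) :
    (μ : EReal) * (dcObjective g (fun x => (f x : EReal)) x
      - ⨅ z, dcObjective g (fun x => (f x : EReal)) z) ≤ s := by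
  rw [dcObjective_eq_coe ha, coe_mul_coe_sub_le_coe_iff hμ]
  refine le_iInf fun z => ?_
  by_cases hz : g z = ⊤
  · simp [dcObjective, hz]
  obtain ⟨c, hc⟩ := hg.exists_coe_eq hz
  rw [dcObjective_eq_coe hc, ← coe_mul_coe_sub_le_coe_iff hμ]
  exact_mod_cast hs z c hc

theorem phiDCAPL_of_forall_mul_sub_le_phiGap (hg : IsProperFun g) {μ₁ μ₂ : ℝ} (hμ₁ : 0 < μ₁)
    (hμ₂ : 0 < μ₂)
    (hprimal : ∀ {x z : X} {y : Y} {a c : ℝ}, y ∈ phiSubdiff Φ (fun x => (f x : EReal)) x →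
      g x = a → g z = c → ((μ₁ * ((a - f x) - (c - f z)) : ℝ) : EReal) ≤ phiGap Φ g x y)
    (hdual : ∀ {x z : X} {y : Y} {a c : ℝ}, y ∈ phiSubdiff Φ g x → g x = a → g z = c →
      ((μ₂ * ((a - f x) - (c - f z)) : ℝ) : EReal) ≤ phiGap Φ (fun x => (f x : EReal)) x y) :
    PhiDCAPL Φ g (fun x => (f x : EReal)) μ₁ μ₂ := by
  refine ⟨add_pos hμ₁ hμ₂, fun x hx y hyf x' hx' => ?_⟩
  have hyg : y ∈ phiSubdiff Φ g x' := mem_phiSubdiff_iff_mem_argminSet.2 hx'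
  obtain ⟨a, ha⟩ := hg.exists_coe_eq_of_dcObjective_lt_top hx
  obtain ⟨b, hb⟩ := hg.exists_coe_eq_of_mem_phiSubdiff hyg
  have hgapg := phiGap_eq_coe_of_mem_phiSubdiff hyg hb ha
  have hgapf := phiGap_eq_coe_of_mem_phiSubdiff hyf (z := x') rfl rfl
  rw [hgapg, hgapf]
  refine add_le_add (coe_mul_dcObjective_sub_iInf_le hg hμ₁ ha fun z c hc => ?_)
    (coe_mul_dcObjective_sub_iInf_le hg hμ₂ hb fun z c hc => ?_)
  · exact EReal.coe_le_coe_iff.1 ((hprimal hyf ha hc).trans_eq hgapg)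
  · exact EReal.coe_le_coe_iff.1 ((hdual hyg hb hc).trans_eq hgapf)

/- The two gaps add up to the decrease `F x - F x'`, so the PL inequality bounds this decrease. -/
theorem PhiDCAPL.dcObjective_sub_iInf_le {μ₁ μ₂ : ℝ}
    (hPL : PhiDCAPL Φ g (fun x => (f x : EReal)) μ₁ μ₂) (hμ₁ : 0 ≤ μ₁) (hμ₂ : 0 ≤ μ₂)
    (hg : IsProperFun g) (hyf : y ∈ phiSubdiff Φ (fun x => (f x : EReal)) x)
    (hyg : y ∈ phiSubdiff Φ g x') (hx : dcObjective g (fun x => (f x : EReal)) x < ⊤) :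
    dcObjective g (fun x => (f x : EReal)) x' - (⨅ z, dcObjective g (fun x => (f x : EReal)) z)
      ≤ (((1 - μ₁) / (1 + μ₂) : ℝ) : EReal) * (dcObjective g (fun x => (f x : EReal)) x
        - ⨅ z, dcObjective g (fun x => (f x : EReal)) z) := by
  obtain ⟨a, ha⟩ := hg.exists_coe_eq_of_dcObjective_lt_top hx
  obtain ⟨b, hb⟩ := hg.exists_coe_eq_of_mem_phiSubdiff hyg
  have hle := hPL.2 x hx y hyf x' (mem_phiSubdiff_iff_mem_argminSet.1 hyg)
  have hinf_le : (⨅ z, dcObjective g (fun x => (f x : EReal)) z)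
      ≤ dcObjective g (fun x => (f x : EReal)) x := iInf_le _ x
  rw [phiGap_eq_coe_of_mem_phiSubdiff hyg hb ha,
    phiGap_eq_coe_of_mem_phiSubdiff hyf (z := x') rfl rfl] at hle
  rw [dcObjective_eq_coe ha, dcObjective_eq_coe hb] at hle ⊢
  rw [dcObjective_eq_coe ha] at hinf_le
  generalize (⨅ z, dcObjective g (fun x => (f x : EReal)) z) = I at hle hinf_le ⊢
  induction I with
  | top => exact absurd hinf_le (EReal.coe_lt_top _).not_ge
  | bot =>
    rw [EReal.coe_sub_bot, EReal.coe_sub_bot, ← EReal.right_distrib_of_nonneg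
      (EReal.coe_nonneg.2 hμ₁) (EReal.coe_nonneg.2 hμ₂), ← EReal.coe_add,
      EReal.coe_mul_top_of_pos hPL.1, ← EReal.coe_add] at hle
    exact absurd hle (EReal.coe_lt_top _).not_ge
  | coe I =>
    norm_cast at hle ⊢
    rw [div_mul_eq_mul_div, le_div_iff₀ (by positivity)]
    linarith

end Coupling

section ConvexAnalysis

open Topology

lemma exists_linear_growth_of_strict_min {E : Type*} [NormedAddCommGroup E] [NormedSpace ℝ E]
    [FiniteDimensional ℝ E] {φ : E → ℝ} (hφ : ConvexOn ℝ univ φ) {z : E}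
    (hz : ∀ x ≠ z, φ z < φ x) {ε : ℝ} (hε : 0 < ε) :
    ∃ m > 0, ∀ x, ε ≤ ‖x - z‖ → m * ‖x - z‖ ≤ φ x - φ z := by
  have : ProperSpace E := FiniteDimensional.proper_real E
  have hcont : Continuous φ := by
    simpa [continuousOn_univ] using hφ.continuousOn_interior
  obtain ⟨c, hzc, hc⟩ := (isCompact_sphere z ε).exists_forall_le' hcont.continuousOn
    fun x hx => hz x (Metric.ne_of_mem_sphere hx hε.ne')
  refine ⟨(c - φ z) / ε, div_pos (sub_pos.2 hzc) hε, fun x hx => ?_⟩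
  have hxz : 0 < ‖x - z‖ := hε.trans_le hx
  set s := ε / ‖x - z‖ with hs
  have hs0 : 0 < s := div_pos hε hxz
  have hs1 : s ≤ 1 := (div_le_one hxz).2 hx
  have hmem : AffineMap.lineMap z x s ∈ Metric.sphere z ε := by
    rw [mem_sphere_iff_norm, ← dist_eq_norm, dist_lineMap_left, Real.norm_of_nonneg hs0.le,
      dist_comm, dist_eq_norm, hs, div_mul_cancel₀ _ hxz.ne']
  have hseg : φ (AffineMap.lineMap z x s) ≤ (1 - s) * φ z + s * φ x := by
    rw [AffineMap.lineMap_apply_module]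
    exact hφ.2 (mem_univ z) (mem_univ x) (sub_nonneg.2 hs1) hs0.le (by ring)
  have hslope : c - φ z ≤ s * (φ x - φ z) := by linarith [hc _ hmem]
  calc (c - φ z) / ε * ‖x - z‖ ≤ s * (φ x - φ z) / ε * ‖x - z‖ := by gcongr
    _ = φ x - φ z := by rw [hs]; field_simp

lemma mul_sub_le_add_smul_sub_of_convexOn {E : Type*} [AddCommGroup E] [Module ℝ E] {φ : E → ℝ}
    (hφ : ConvexOn ℝ univ φ) {t : ℝ} (ht : 0 ≤ t) (x z : E) :
    t * (φ x - φ z) ≤ φ (x + t • (x - z)) - φ x := by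
  have ht1 : 0 < 1 + t := by positivity
  have hcomb := hφ.2 (mem_univ (x + t • (x - z))) (mem_univ z)
    (inv_nonneg.2 ht1.le) (div_nonneg ht ht1.le) (by field_simp)
  have hx : (1 + t)⁻¹ • (x + t • (x - z)) + (t / (1 + t)) • z = x := by
    match_scalars <;> field_simp
    ring
  rw [hx, smul_eq_mul, smul_eq_mul, inv_mul_eq_div, div_mul_eq_mul_div, ← add_div,
    le_div_iff₀ ht1] at hcomb
  linarith

lemma le_coe_of_convex_epigraph {E : Type*} [AddCommGroup E] [Module ℝ E] {ψ : E → EReal}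
    (hψ : Convex ℝ {p : E × ℝ | ψ p.1 ≤ (p.2 : EReal)}) {x z : E} {a c t : ℝ}
    (hx : ψ x = a) (hz : ψ z = c) (ht : t ∈ Icc 0 1) :
    ψ (x + t • (z - x)) ≤ ((a + t * (c - a) : ℝ) : EReal) :=
  hψ.add_smul_sub_mem (x := (x, a)) (y := (z, c)) hx.le hz.le ht

variable {n : ℕ} {h φ q : EuclideanSpace ℝ (Fin n) → ℝ} {ψ : EuclideanSpace ℝ (Fin n) → EReal}
  {u v x z : EuclideanSpace ℝ (Fin n)}

lemma coe_mem_convexSubdiff_iff :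
    u ∈ convexSubdiff (fun x => (φ x : EReal)) z ↔ ∀ x, φ z + inner ℝ u (x - z) ≤ φ x := by
  simp only [convexSubdiff, mem_ofPred_eq, ← EReal.coe_add, EReal.coe_le_coe_iff]

lemma convex_epigraph_coe_iff :
    Convex ℝ {p : EuclideanSpace ℝ (Fin n) × ℝ | (φ p.1 : EReal) ≤ (p.2 : EReal)}
      ↔ ConvexOn ℝ univ φ := by
  simp [convexOn_iff_convex_epigraph]

/- The linear form `(z, r) ↦ r - ⟪v, z⟫` is the derivative of `(z, r) ↦ r - q z`, which is minimal
over the epigraph of `ψ` at `(x, ψ x)`. -/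
lemma mem_convexSubdiff_of_hasGradientAt_minorant
    (hψ : Convex ℝ {p : EuclideanSpace ℝ (Fin n) × ℝ | ψ p.1 ≤ (p.2 : EReal)})
    (hq : HasGradientAt q v x) {a : ℝ} (ha : ψ x = a)
    (hle : ∀ z, ψ x + ((q z - q x : ℝ) : EReal) ≤ ψ z) : v ∈ convexSubdiff ψ x := by
  intro z
  rw [ha, ← EReal.coe_add, ← EReal.le_of_forall_lt_iff_le]
  intro r hr
  have hderiv : HasFDerivAt (fun p : EuclideanSpace ℝ (Fin n) × ℝ => p.2 - q p.1)
      (ContinuousLinearMap.snd ℝ _ ℝ - (InnerProductSpace.toDual ℝ _ v).comp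
        (ContinuousLinearMap.fst ℝ _ ℝ)) (x, a) :=
    hasFDerivAt_snd.sub (HasFDerivAt.comp (x, a) hq.hasFDerivAt hasFDerivAt_fst)
  have hmin : IsMinOn (fun p : EuclideanSpace ℝ (Fin n) × ℝ => p.2 - q p.1)
      {p | ψ p.1 ≤ (p.2 : EReal)} (x, a) := by
    intro p hp
    have := (hle p.1).trans hp
    rw [ha] at this
    norm_cast at this
    simp only [mem_ofPred_eq]
    linarith
  have hnonneg := hmin.localize.hasFDerivWithinAt_nonneg hderiv.hasFDerivWithinAt
    (sub_mem_posTangentConeAt_of_segment_subset (y := (z, r))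
      (hψ.segment_subset ha.le hr.le))
  simp only [Prod.mk_sub_mk, sub_apply, ContinuousLinearMap.coe_snd',
    ContinuousLinearMap.comp_apply, ContinuousLinearMap.coe_fst',
    InnerProductSpace.toDual_apply_apply, sub_nonneg] at hnonneg
  exact_mod_cast (by linarith : a + inner ℝ v (z - x) ≤ r)

/- Reflecting the majorant through `x` turns it into a minorant, by midpoint convexity. -/
lemma mem_convexSubdiff_of_hasGradientAt_majorant (hφ : ConvexOn ℝ univ φ)
    (hq : HasGradientAt q v x) (hle : ∀ z, φ z ≤ φ x + (q z - q x)) :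
    v ∈ convexSubdiff (fun x => (φ x : EReal)) x := by
  have hrefl : HasGradientAt (fun z => -q ((2 : ℝ) • x - z)) v x := by
    rw [hasGradientAt_iff_hasFDerivAt] at hq ⊢
    have hx : x = (2 : ℝ) • x - x := by module
    rw [hx] at hq
    refine (hq.comp x ((hasFDerivAt_id x).const_sub _)).neg.congr_fderiv ?_
    ext d
    simp
  refine mem_convexSubdiff_of_hasGradientAt_minorant (convex_epigraph_coe_iff.2 hφ) hrefl rfl
    fun z => ?_
  have hmid := hφ.2 (mem_univ z) (mem_univ ((2 : ℝ) • x - z)) one_half_pos.le one_half_pos.le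
    (add_halves (1 : ℝ))
  rw [show (1 / 2 : ℝ) • z + (1 / 2 : ℝ) • ((2 : ℝ) • x - z) = x by module] at hmid
  simp only [smul_eq_mul] at hmid
  rw [show (2 : ℝ) • x - x = x by module, ← EReal.coe_add, EReal.coe_le_coe_iff]
  linarith [hle ((2 : ℝ) • x - z)]

lemma mem_convexSubdiff_of_hasGradientAt (hφ : ConvexOn ℝ univ φ) (hv : HasGradientAt φ v x) :
    v ∈ convexSubdiff (fun x => (φ x : EReal)) x :=
  mem_convexSubdiff_of_hasGradientAt_majorant hφ hv fun z => by simp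

lemma add_inner_lt_of_mem_convexSubdiff (hh : StrictConvexOn ℝ univ h)
    (hu : u ∈ convexSubdiff (fun x => (h x : EReal)) z) (hx : x ≠ z) :
    h z + inner ℝ u (x - z) < h x := by
  have hmid := hh.2 (mem_univ x) (mem_univ z) hx one_half_pos one_half_pos (add_halves (1 : ℝ))
  have hsub := coe_mem_convexSubdiff_iff.1 hu ((1 / 2 : ℝ) • x + (1 / 2 : ℝ) • z)
  rw [show (1 / 2 : ℝ) • x + (1 / 2 : ℝ) • z - z = (1 / 2 : ℝ) • (x - z) by module,
    inner_smul_right] at hsub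
  simp only [smul_eq_mul] at hmid
  linarith

lemma coe_le_fenchelConj (h : EuclideanSpace ℝ (Fin n) → ℝ) (v z : EuclideanSpace ℝ (Fin n)) :
    ((inner ℝ v z - h z : ℝ) : EReal) ≤ fenchelConj h v :=
  le_iSup (fun x => ((inner ℝ v x - h x : ℝ) : EReal)) z

lemma fenchelConj_eq_of_mem_convexSubdiff (hu : u ∈ convexSubdiff (fun x => (h x : EReal)) z) :
    fenchelConj h u = ((inner ℝ u z - h z : ℝ) : EReal) := by
  refine le_antisymm (iSup_le fun x => EReal.coe_le_coe_iff.2 ?_) (coe_le_fenchelConj h u z)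
  have := coe_mem_convexSubdiff_iff.1 hu x
  rw [inner_sub_right] at this
  linarith

/- In the supremum over `x`, the term `⟪v - u, x - z⟫` is absorbed by the linear growth of
`h - ⟪u, ·⟫` where `ε ≤ ‖x - z‖`, and is at most `ε * ‖v - u‖` elsewhere. -/
lemma eventually_fenchelConj_le (hh : StrictConvexOn ℝ univ h)
    (hu : u ∈ convexSubdiff (fun x => (h x : EReal)) z) {ε : ℝ} (hε : 0 < ε) :
    ∀ᶠ v in 𝓝 u, fenchelConj h v ≤ ((inner ℝ v z - h z + ε * ‖v - u‖ : ℝ) : EReal) := by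
  have hconvex : ConvexOn ℝ univ (fun x => h x - inner ℝ u x) :=
    hh.convexOn.sub ((innerₗ _ u).concaveOn convex_univ)
  obtain ⟨m, hm, hgrowth⟩ := exists_linear_growth_of_strict_min hconvex (z := z) (fun x hx => by
    have := add_inner_lt_of_mem_convexSubdiff hh hu hx
    rw [inner_sub_right] at this
    linarith) hε
  filter_upwards [Metric.closedBall_mem_nhds u hm] with v hv
  refine iSup_le fun x => EReal.coe_le_coe_iff.2 ?_
  have hcs : inner ℝ (v - u) (x - z) ≤ ‖v - u‖ * ‖x - z‖ := real_inner_le_norm _ _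
  simp only [inner_sub_left, inner_sub_right] at hcs
  rcases le_or_gt ε ‖x - z‖ with hfar | hnear
  · have hvm : ‖v - u‖ * ‖x - z‖ ≤ m * ‖x - z‖ := by gcongr; exact mem_closedBall_iff_norm.1 hv
    have hnonneg : 0 ≤ ε * ‖v - u‖ := by positivity
    linarith [hgrowth x hfar]
  · have hsub := coe_mem_convexSubdiff_iff.1 hu x
    rw [inner_sub_right] at hsub
    have hvε : ‖v - u‖ * ‖x - z‖ ≤ ‖v - u‖ * ε := by gcongr
    linarith

lemma mem_interior_fenchelDom (hh : StrictConvexOn ℝ univ h)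
    (hu : u ∈ convexSubdiff (fun x => (h x : EReal)) z) : u ∈ interior (fenchelDom h) := by
  rw [mem_interior_iff_mem_nhds]
  filter_upwards [eventually_fenchelConj_le hh hu one_pos] with v hv
  exact hv.trans_lt (EReal.coe_lt_top _)

lemma hasGradientAt_toReal_fenchelConj (hh : StrictConvexOn ℝ univ h)
    (hu : u ∈ convexSubdiff (fun x => (h x : EReal)) z) :
    HasGradientAt (fun v => (fenchelConj h v).toReal) z u := by
  rw [hasGradientAt_iff_isLittleO, Asymptotics.isLittleO_iff]
  intro ε hε
  filter_upwards [eventually_fenchelConj_le hh hu hε] with v hupper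
  have hlower := coe_le_fenchelConj h v z
  lift fenchelConj h v to ℝ using
    ⟨(hupper.trans_lt (EReal.coe_lt_top _)).ne, ((EReal.bot_lt_coe _).trans_le hlower).ne'⟩ with r
  rw [EReal.coe_le_coe_iff] at hupper hlower
  rw [fenchelConj_eq_of_mem_convexSubdiff hu, EReal.toReal_coe, EReal.toReal_coe, inner_sub_right,
    real_inner_comm v z, real_inner_comm u z, Real.norm_eq_abs, abs_le]
  have hnonneg : 0 ≤ ε * ‖v - u‖ := by positivity
  exact ⟨by linarith [hnonneg], by linarith⟩

lemma gradConj_eq_of_mem_convexSubdiff (hh : StrictConvexOn ℝ univ h)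
    (hu : u ∈ convexSubdiff (fun x => (h x : EReal)) z) : gradConj h u = z :=
  (hasGradientAt_toReal_fenchelConj hh hu).gradient

lemma IsFullLegendre.gradient_mem_convexSubdiff (hh : IsFullLegendre h)
    (z : EuclideanSpace ℝ (Fin n)) :
    gradient h z ∈ convexSubdiff (fun x => (h x : EReal)) z :=
  mem_convexSubdiff_of_hasGradientAt hh.strictConvex.convexOn (hh.differentiable z).hasGradientAt

lemma gradient_reflect_neg (hh : DifferentiableAt ℝ h z) :
    gradient (reflect h) (-z) = -gradient h z := by
  have hz : HasFDerivAt h (InnerProductSpace.toDual ℝ _ (gradient h z)) (-(-z)) := by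
    rw [neg_neg]
    exact hh.hasGradientAt.hasFDerivAt
  refine HasGradientAt.gradient (hasGradientAt_iff_hasFDerivAt.2 ?_)
  refine (hz.comp (-z) (hasFDerivAt_id (-z)).neg).congr_fderiv ?_
  ext d
  simp

lemma IsFullLegendre.reflect (hh : IsFullLegendre h) : IsFullLegendre (reflect h) := by
  refine ⟨hh.differentiable.comp differentiable_id.neg, convex_univ, ?_⟩
  intro x _ y _ hxy a b ha hb hab
  have hlt := hh.strictConvex.2 (mem_univ (-x)) (mem_univ (-y)) (neg_injective.ne hxy) ha hb hab
  rwa [show a • -x + b • -y = -(a • x + b • y) by module] at hlt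

end ConvexAnalysis

section AnisotropicCoupling

variable {n : ℕ} {h f : EuclideanSpace ℝ (Fin n) → ℝ} {g ψ : EuclideanSpace ℝ (Fin n) → EReal}
  {L η : ℝ} {w x y z : EuclideanSpace ℝ (Fin n)}

lemma anisoCoupling_eq (h : EuclideanSpace ℝ (Fin n) → ℝ) (L : ℝ)
    (x y : EuclideanSpace ℝ (Fin n)) : anisoCoupling h L x y = -(L⁻¹ * h (L • (x - y))) := by
  simp [anisoCoupling, epiScale]

lemma anisoCoupling_add_div_smul (h : EuclideanSpace ℝ (Fin n) → ℝ) (hL : L ≠ 0) (η : ℝ)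
    (x y d : EuclideanSpace ℝ (Fin n)) :
    anisoCoupling h L (x + (η / L) • d) y = -(L⁻¹ * h (η • d + L • (x - y))) := by
  rw [anisoCoupling_eq, add_sub_right_comm, smul_add, smul_smul, mul_div_cancel₀ _ hL, add_comm]

lemma sub_coe_anisoCoupling (ψ : EuclideanSpace ℝ (Fin n) → EReal)
    (h : EuclideanSpace ℝ (Fin n) → ℝ) (L : ℝ) (x y : EuclideanSpace ℝ (Fin n)) :
    ψ x - (anisoCoupling h L x y : EReal) = ψ x + (epiScale (1 / L) h (x - y) : EReal) := by
  rw [anisoCoupling, EReal.coe_neg, sub_eq_add_neg, neg_neg]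

lemma hasGradientAt_anisoCoupling (hL : L ≠ 0) (hh : DifferentiableAt ℝ h (L • (x - y))) :
    HasGradientAt (fun x => anisoCoupling h L x y) (-gradient h (L • (x - y))) x := by
  simp only [anisoCoupling_eq]
  have hinner : HasFDerivAt (fun x => L • (x - y)) (L • ContinuousLinearMap.id ℝ _) x :=
    ((hasFDerivAt_id x).sub_const y).const_smul L
  rw [hasGradientAt_iff_hasFDerivAt]
  refine ((hh.hasGradientAt.hasFDerivAt.comp x hinner).const_mul L⁻¹).neg.congr_fderiv ?_
  ext d
  simp [hL]

lemma strictConcaveOn_anisoCoupling (hh : StrictConvexOn ℝ univ h) (hL : 0 < L)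
    (y : EuclideanSpace ℝ (Fin n)) : StrictConcaveOn ℝ univ (fun x => anisoCoupling h L x y) := by
  refine ⟨convex_univ, fun x _ z _ hxz a b ha hb hab => ?_⟩
  have hne : L • (x - y) ≠ L • (z - y) := fun heq =>
    hxz (sub_left_injective (smul_right_injective _ hL.ne' heq))
  have hlt := hh.2 (mem_univ _) (mem_univ _) hne ha hb hab
  have harg : a • L • (x - y) + b • L • (z - y) = L • (a • x + b • z - y) := by
    have : a • L • (x - y) + b • L • (z - y) = L • (a • x + b • z - (a + b) • y) := by module
    rw [this, hab, one_smul]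
  rw [harg, smul_eq_mul, smul_eq_mul] at hlt
  have := mul_lt_mul_of_pos_left hlt (inv_pos.2 hL)
  simp only [anisoCoupling_eq, smul_eq_mul]
  linarith

lemma AnisoSmooth.mem_phiSubdiff (hf : AnisoSmooth h L (fun x => -f x))
    (x : EuclideanSpace ℝ (Fin n)) :
    x - L⁻¹ • gradConj h (-gradient f x)
      ∈ phiSubdiff (anisoCoupling h L) (fun x => (f x : EReal)) x := by
  refine coe_mem_phiSubdiff_iff.2 fun z => ?_
  have hgrad : gradient (fun x => -f x) x = -gradient f x := by simp [gradient, fderiv_fun_neg]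
  have hdescent := hf.descent x z
  rw [hgrad] at hdescent
  rw [anisoCoupling, anisoCoupling, sub_sub_cancel, ← sub_add]
  linarith

lemma gradient_mem_convexSubdiff_neg_of_mem_phiSubdiff (hL : L ≠ 0)
    (hh : DifferentiableAt ℝ h (L • (x - y))) (hf : ConvexOn ℝ univ (fun x => -f x))
    (hy : y ∈ phiSubdiff (anisoCoupling h L) (fun x => (f x : EReal)) x) :
    gradient h (L • (x - y)) ∈ convexSubdiff (fun x => ((-f x : ℝ) : EReal)) x := by
  have hgrad : HasGradientAt (fun x => -anisoCoupling h L x y) (gradient h (L • (x - y))) x := by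
    rw [hasGradientAt_iff_hasFDerivAt]
    simpa only [map_neg, neg_neg] using! (hasGradientAt_anisoCoupling hL hh).hasFDerivAt.neg
  refine mem_convexSubdiff_of_hasGradientAt_majorant hf hgrad fun z => ?_
  linarith [coe_mem_phiSubdiff_iff.1 hy z]

lemma neg_gradient_mem_convexSubdiff_of_mem_phiSubdiff (hL : L ≠ 0)
    (hh : DifferentiableAt ℝ h (L • (x - y)))
    (hψ : Convex ℝ {p : EuclideanSpace ℝ (Fin n) × ℝ | ψ p.1 ≤ (p.2 : EReal)})
    (hy : y ∈ phiSubdiff (anisoCoupling h L) ψ x) {a : ℝ} (ha : ψ x = a) :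
    -gradient h (L • (x - y)) ∈ convexSubdiff ψ x :=
  mem_convexSubdiff_of_hasGradientAt_minorant hψ (hasGradientAt_anisoCoupling hL hh) ha hy

lemma AnisoStronglyConvex.sub_le_mul_sub_of_gradient_mem (hh : IsFullLegendre h) (hη : 0 < η)
    (hψ : AnisoStronglyConvex h η ψ) (hw : gradient h w ∈ convexSubdiff ψ x) {b c : ℝ}
    (hb : ψ x = b) (hc : ψ z = c) : h (η • (z - x) + w) - h w ≤ η * (c - b) := by
  have hsub := hh.gradient_mem_convexSubdiff w
  have hbound := hψ.lower_bound x _ hw (mem_interior_fenchelDom hh.strictConvex hsub) z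
  rw [gradConj_eq_of_mem_convexSubdiff hh.strictConvex hsub, hb, hc, ← EReal.coe_add,
    EReal.coe_le_coe_iff] at hbound
  simp only [epiScale, one_div, inv_inv, smul_add, smul_inv_smul₀ hη.ne'] at hbound
  rw [← mul_sub, ← le_sub_iff_add_le', inv_mul_le_iff₀ hη] at hbound
  exact hbound

lemma AnisoStronglyConvex.anisoCoupling_sub_le_of_neg (hh : IsFullLegendre h) (hL : 0 < L)
    (hη : 0 < η) (hf : AnisoStronglyConvex h η (fun x => ((-f x : ℝ) : EReal)))
    (hy : y ∈ phiSubdiff (anisoCoupling h L) (fun x => (f x : EReal)) x)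
    (z : EuclideanSpace ℝ (Fin n)) :
    anisoCoupling h L x y - anisoCoupling h L (x + (η / L) • (z - x)) y
      ≤ η / L * (f x - f z) := by
  have hsub := gradient_mem_convexSubdiff_neg_of_mem_phiSubdiff hL.ne' (hh.differentiable _)
    (convex_epigraph_coe_iff.1 hf.gammaZero.2.2) hy
  have hbound := mul_le_mul_of_nonneg_left
    (hf.sub_le_mul_sub_of_gradient_mem hh hη hsub (z := z) rfl rfl) (inv_pos.2 hL).le
  rw [anisoCoupling_add_div_smul h hL.ne', anisoCoupling_eq]
  calc -(L⁻¹ * h (L • (x - y))) - -(L⁻¹ * h (η • (z - x) + L • (x - y)))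
      = L⁻¹ * (h (η • (z - x) + L • (x - y)) - h (L • (x - y))) := by ring
    _ ≤ L⁻¹ * (η * (-f z - -f x)) := hbound
    _ = η / L * (f x - f z) := by ring

lemma AnisoStronglyConvex.anisoCoupling_sub_le_of_reflect (hh : IsFullLegendre h) (hL : 0 < L)
    (hη : 0 < η) (hg : AnisoStronglyConvex (reflect h) η g)
    (hy : y ∈ phiSubdiff (anisoCoupling h L) g x) {b c : ℝ} (hb : g x = b) (hc : g z = c) :
    anisoCoupling h L x y - anisoCoupling h L (x + (η / L) • (x - z)) y ≤ η / L * (c - b) := by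
  have hsub := neg_gradient_mem_convexSubdiff_of_mem_phiSubdiff hL.ne' (hh.differentiable _)
    hg.gammaZero.2.2 hy hb
  rw [← gradient_reflect_neg (hh.differentiable _)] at hsub
  have hbound := mul_le_mul_of_nonneg_left
    (hg.sub_le_mul_sub_of_gradient_mem hh.reflect hη hsub hb hc) (inv_pos.2 hL).le
  have harg : -(η • (z - x) + -(L • (x - y))) = η • (x - z) + L • (x - y) := by module
  rw [reflect, reflect, harg, neg_neg] at hbound
  rw [anisoCoupling_add_div_smul h hL.ne', anisoCoupling_eq]
  calc -(L⁻¹ * h (L • (x - y))) - -(L⁻¹ * h (η • (x - z) + L • (x - y)))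
      = L⁻¹ * (h (η • (x - z) + L • (x - y)) - h (L • (x - y))) := by ring
    _ ≤ L⁻¹ * (η * (c - b)) := hbound
    _ = η / L * (c - b) := by ring

lemma AnisoStronglyConvex.modulus_le_of_mem_phiSubdiff (hh : IsFullLegendre h) (hL : 0 < L)
    (hη : 0 < η) (hf : AnisoStronglyConvex h η (fun x => ((-f x : ℝ) : EReal)))
    (hy : y ∈ phiSubdiff (anisoCoupling h L) (fun x => (f x : EReal)) x) (hzx : z ≠ x) :
    η ≤ L := by
  by_contra! hlt
  have hstrong := hf.anisoCoupling_sub_le_of_neg hh hL hη hy z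
  have hsub := coe_mem_phiSubdiff_iff.1 hy z
  have ht : 0 < η / L := div_pos hη hL
  set p := x + (η / L) • (z - x) with hp
  have hpx : x ≠ p := by simp [hp, sub_eq_zero, hzx, ht.ne']
  have hstrict := (strictConcaveOn_anisoCoupling hh.strictConvex hL y).2 (mem_univ x)
    (mem_univ p) hpx (sub_pos.2 ((div_lt_one hη).2 hlt)) (div_pos hL hη) (sub_add_cancel _ _)
  have hz : (1 - L / η) • x + (L / η) • p = z := by
    rw [hp, smul_add, smul_smul, div_mul_div_cancel₀ hη.ne', div_self hL.ne']
    module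
  rw [hz] at hstrict
  have hscaled := mul_lt_mul_of_pos_left hstrict ht
  have hlhs : η / L * ((1 - L / η) * anisoCoupling h L x y + L / η * anisoCoupling h L p y)
      = (η / L - 1) * anisoCoupling h L x y + anisoCoupling h L p y := by field_simp
  rw [smul_eq_mul, smul_eq_mul, hlhs] at hscaled
  linarith [mul_le_mul_of_nonneg_left hsub ht.le]

theorem AnisoStronglyConvex.mul_sub_le_phiGap_primal (hh : IsFullLegendre h) (hL : 0 < L)
    (hη : 0 < η) (hf : AnisoStronglyConvex h η (fun x => ((-f x : ℝ) : EReal)))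
    (hg : Convex ℝ {p : EuclideanSpace ℝ (Fin n) × ℝ | g p.1 ≤ (p.2 : EReal)})
    (hy : y ∈ phiSubdiff (anisoCoupling h L) (fun x => (f x : EReal)) x) {a c : ℝ}
    (ha : g x = a) (hc : g z = c) :
    ((η / L * ((a - f x) - (c - f z)) : ℝ) : EReal) ≤ phiGap (anisoCoupling h L) g x y := by
  have hconv : g (x + (η / L) • (z - x)) ≤ ((a + η / L * (c - a) : ℝ) : EReal) := by
    rcases eq_or_ne z x with rfl | hzx
    · obtain rfl : a = c := EReal.coe_injective (ha.symm.trans hc)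
      simp [ha]
    · exact le_coe_of_convex_epigraph hg ha hc ⟨(div_pos hη hL).le, (div_le_one hL).2
        (hf.modulus_le_of_mem_phiSubdiff hh hL hη hy hzx)⟩
  refine le_trans (EReal.coe_le_coe_iff.2 ?_) (coe_sub_add_le_phiGap ha hconv)
  linarith [hf.anisoCoupling_sub_le_of_neg hh hL hη hy z]

theorem AnisoStronglyConvex.mul_sub_le_phiGap_dual (hh : IsFullLegendre h) (hL : 0 < L)
    (hη : 0 < η) (hg : AnisoStronglyConvex (reflect h) η g) (hf : ConvexOn ℝ univ (fun x => -f x))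
    (hy : y ∈ phiSubdiff (anisoCoupling h L) g x) {b c : ℝ} (hb : g x = b) (hc : g z = c) :
    ((η / L * ((b - f x) - (c - f z)) : ℝ) : EReal)
      ≤ phiGap (anisoCoupling h L) (fun x => (f x : EReal)) x y := by
  refine le_trans (EReal.coe_le_coe_iff.2 ?_)
    (coe_sub_add_le_phiGap (z := x + (η / L) • (x - z)) rfl le_rfl)
  linarith [mul_sub_le_add_smul_sub_of_convexOn hf (div_pos hη hL).le x z,
    hg.anisoCoupling_sub_le_of_reflect hh hL hη hy hb hc]

theorem phiDCAPL_of_anisoStronglyConvex (hh : IsFullLegendre h) (hL : 0 < L) {ηf ηg : ℝ}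
    (hηf : 0 < ηf) (hηg : 0 < ηg) (hf : AnisoStronglyConvex h ηf (fun x => ((-f x : ℝ) : EReal)))
    (hg : AnisoStronglyConvex (reflect h) ηg g) :
    PhiDCAPL (anisoCoupling h L) g (fun x => (f x : EReal)) (ηf / L) (ηg / L) :=
  phiDCAPL_of_forall_mul_sub_le_phiGap hg.gammaZero.1 (div_pos hηf hL) (div_pos hηg hL)
    (fun hy ha hc =>
      hf.mul_sub_le_phiGap_primal hh hL hηf hg.gammaZero.2.2 hy ha hc)
    fun hy ha hc => hg.mul_sub_le_phiGap_dual hh hL hηg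
      (convex_epigraph_coe_iff.1 hf.gammaZero.2.2) hy ha hc

theorem phiGap_anisoCoupling_eq_sub_iInf (h : EuclideanSpace ℝ (Fin n) → ℝ) (L : ℝ)
    (ψ : EuclideanSpace ℝ (Fin n) → EReal) (x y : EuclideanSpace ℝ (Fin n)) :
    phiGap (anisoCoupling h L) ψ x y
      = ψ x - (⨅ z, (ψ z + (epiScale (1 / L) h (z - y) : EReal)))
        + (epiScale (1 / L) h (x - y) : EReal) := by
  rw [phiGap_eq_sub_iInf, anisoCoupling, neg_neg]
  simp only [sub_coe_anisoCoupling]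

theorem AnisoSmooth.phiGap_eq (hf : AnisoSmooth h L (fun x => -f x))
    (x z : EuclideanSpace ℝ (Fin n)) :
    phiGap (anisoCoupling h L) (fun x => (f x : EReal)) z (x - L⁻¹ • gradConj h (-gradient f x))
      = ((-f x + f z + epiScale (1 / L) h (z - (x - L⁻¹ • gradConj h (-gradient f x)))
        - epiScale (1 / L) h (L⁻¹ • gradConj h (-gradient f x)) : ℝ) : EReal) := by
  rw [phiGap_eq_coe_of_mem_phiSubdiff (hf.mem_phiSubdiff x) rfl rfl, anisoCoupling, anisoCoupling,
    sub_sub_cancel]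
  congr 1
  ring

end AnisotropicCoupling

theorem mainTheorem6_general {n : ℕ}
    (h : EuclideanSpace ℝ (Fin n) → ℝ) (hh : IsFullLegendre h) (L : ℝ) (hL : 0 < L)
    (f : EuclideanSpace ℝ (Fin n) → ℝ) (g : EuclideanSpace ℝ (Fin n) → EReal) :
    (∀ xbar ybar : EuclideanSpace ℝ (Fin n), ybar = xbar - L⁻¹ • gradConj h (-gradient f xbar) →
      phiGap (anisoCoupling h L) g xbar ybar
          = g xbar - (⨅ x, (g x + ((epiScale (1 / L) h (x - ybar) : ℝ) : EReal)))
            + ((epiScale (1 / L) h (L⁻¹ • gradConj h (-gradient f xbar)) : ℝ) : EReal) ∧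
      (AnisoSmooth h L (fun x => -f x) → ∀ xplus : EuclideanSpace ℝ (Fin n),
        phiGap (anisoCoupling h L) (fun x => ((f x : ℝ) : EReal)) xplus ybar
          = ((-f xbar + f xplus + epiScale (1 / L) h (xplus - ybar)
            - epiScale (1 / L) h (L⁻¹ • gradConj h (-gradient f xbar)) : ℝ) : EReal))) ∧
    (∀ ηf ηg : ℝ, 0 < ηf → 0 < ηg →
      AnisoStronglyConvex h ηf (fun x => ((-f x : ℝ) : EReal)) →
      AnisoStronglyConvex (reflect h) ηg g →
        PhiDCAPL (anisoCoupling h L) g (fun x => ((f x : ℝ) : EReal)) (ηf / L) (ηg / L) ∧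
        (1 - ηf / L) / (1 + ηg / L) < 1 ∧
        ∀ x y : ℕ → EuclideanSpace ℝ (Fin n),
          IsPhiDCA (anisoCoupling h L) g (fun x => ((f x : ℝ) : EReal)) x y →
          ∀ k, dcObjective g (fun x => ((f x : ℝ) : EReal)) (x k) < ⊤ →
            dcObjective g (fun x => ((f x : ℝ) : EReal)) (x (k + 1))
                - (⨅ z, dcObjective g (fun x => ((f x : ℝ) : EReal)) z)
              ≤ (((1 - ηf / L) / (1 + ηg / L) : ℝ) : EReal)
                * (dcObjective g (fun x => ((f x : ℝ) : EReal)) (x k)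
                  - (⨅ z, dcObjective g (fun x => ((f x : ℝ) : EReal)) z))) := by
  refine ⟨?_, fun ηf ηg hηf hηg hfs hgs => ?_⟩
  · rintro xbar _ rfl
    refine ⟨?_, fun hf => hf.phiGap_eq xbar⟩
    rw [phiGap_anisoCoupling_eq_sub_iInf, sub_sub_cancel]
  have hμf : 0 < ηf / L := div_pos hηf hL
  have hμg : 0 < ηg / L := div_pos hηg hL
  have hPL := phiDCAPL_of_anisoStronglyConvex hh hL hηf hηg hfs hgs
  refine ⟨hPL, (div_lt_one (by positivity)).2 (by linarith), fun x y hxy k hk => ?_⟩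
  exact hPL.dcObjective_sub_iInf_le hμf.le hμg.le hgs.gammaZero.1 (hxy k).1 (hxy k).2 hk

theorem mainTheorem6 {n : ℕ}
    (h : EuclideanSpace ℝ (Fin n) → ℝ) (hh : IsFullLegendre h)
    (L : ℝ) (hL : 0 < L)
    (f : EuclideanSpace ℝ (Fin n) → ℝ) (hf : AnisoSmooth h L (fun x => -f x))
    (g : EuclideanSpace ℝ (Fin n) → EReal) (hg : IsProperFun g) (hg_lsc : LowerSemicontinuous g)
    (hg_lb : ∀ y, IsLevelBounded (fun x => g x + ((epiScale (1 / L) h (x - y) : ℝ) : EReal))) :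
    -- explicit forms of the primal and dual gaps
    (∀ xbar ybar xplus : EuclideanSpace ℝ (Fin n),
      ybar = xbar - L⁻¹ • gradConj h (-gradient f xbar) →
      xplus ∈ argminSet (fun x => g x + ((epiScale (1 / L) h (x - ybar) : ℝ) : EReal)) →
        phiGap (anisoCoupling h L) g xbar ybar
            = g xbar - (⨅ x, (g x + ((epiScale (1 / L) h (x - ybar) : ℝ) : EReal)))
              + ((epiScale (1 / L) h (L⁻¹ • gradConj h (-gradient f xbar)) : ℝ) : EReal) ∧
        phiGap (anisoCoupling h L) (fun x => ((f x : ℝ) : EReal)) xplus ybar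
            = ((-f xbar + f xplus + epiScale (1 / L) h (xplus - ybar)
              - epiScale (1 / L) h (L⁻¹ • gradConj h (-gradient f xbar)) : ℝ) : EReal)) ∧
    -- the PL inequality and the resulting q-linear rate
    (∀ ηf ηg : ℝ, 0 < ηf → 0 < ηg →
      AnisoStronglyConvex h ηf (fun x => ((-f x : ℝ) : EReal)) →
      AnisoStronglyConvex (reflect h) ηg g →
        PhiDCAPL (anisoCoupling h L) g (fun x => ((f x : ℝ) : EReal)) (ηf / L) (ηg / L) ∧
        (1 - ηf / L) / (1 + ηg / L) < 1 ∧
        ∀ x y : ℕ → EuclideanSpace ℝ (Fin n),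
          IsPhiDCA (anisoCoupling h L) g (fun x => ((f x : ℝ) : EReal)) x y →
          ∀ k, dcObjective g (fun x => ((f x : ℝ) : EReal)) (x k) < ⊤ →
            dcObjective g (fun x => ((f x : ℝ) : EReal)) (x (k + 1))
                - (⨅ z, dcObjective g (fun x => ((f x : ℝ) : EReal)) z)
              ≤ (((1 - ηf / L) / (1 + ηg / L) : ℝ) : EReal)
                * (dcObjective g (fun x => ((f x : ℝ) : EReal)) (x k)
                  - (⨅ z, dcObjective g (fun x => ((f x : ℝ) : EReal)) z))) := by
  obtain ⟨hgap, hPL⟩ := mainTheorem6_general h hh L hL f g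
  exact ⟨fun xbar ybar xplus hy _ => ⟨(hgap xbar ybar hy).1, (hgap xbar ybar hy).2 hf xplus⟩, hPL⟩
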